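/- An instance consists of a finite ground set $N$ with $|N|=n$, non-negative real weights $(w_i)_{i\in N}$, and monotone submodular functions $f_1,\dots,f_h:2^N\to\mathbb{R}_{\ge 0}$, which an algorithm can access only through a value oracle; write $w(S)=\sum_{i\in S}w_i$. A set $S\subseteq N$ is feasible if $f_j(S)\ge 1$ for all $j\in\{1,\dots,h\}$, and $\mathrm{OPT}$ is the minimum of $w(S)$ over feasible $S$. Element $i$ is active in constraint $j$ if $f_j(\{i\})>0$, and the instance is $r$-sparse if each element is active in at most $r$ constraints. There are a randomized algorithm and an absolute constant $C$ such that, given an instance and a real number $\varepsilon>0$, the algorithm always halts after a number of steps (arithmetic operations and comparisons, oracle queries and fair coin flips, in the real random access machine model with unit-cost real arithmetic) that is bounded by a fixed polynomial in $n$, $h$ and $1/\varepsilon$, and, if the instance has a feasible set, it outputs a random set $S\subseteq N$ such that (i) for every outcome, $f_j(S)\ge 1-\frac1e-\varepsilon$ for all $1\le j\le h$, and (ii) for every integer $r\ge 2$ for which the instance is $r$-sparse, $\mathbb{E}[w(S)]\le C\cdot\frac{1}{\varepsilon}\ln r\cdot \mathrm{OPT}$. (A $1$-sparse instance is in particular $2$-sparse,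 so (ii) with $r=2$ applies to it.) -/

import Mathlib

/-! ### The covering problem -/

/-- An instance of covering with several submodular constraints: ground set `Fin n`, constraint
functions `f j : 2^(Fin n) → ℝ₊` (`j : Fin h`), each monotone and submodular, and non-negative
weights `w`. The constraints are `f j S ≥ 1`. -/
structure CoverInstance (n h : ℕ) where
  f : Fin h → Finset (Fin n) → ℝ
  w : Fin n → ℝ
  f_nonneg : ∀ j S, 0 ≤ f j S
  f_mono : ∀ j, Monotone (f j)
  f_submodular : ∀ j A B, f j (A ∪ B) + f j (A ∩ B) ≤ f j A + f j B
  w_nonneg : ∀ i, 0 ≤ w i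

namespace CoverInstance

variable {n h : ℕ}

/-- The weight of a set. -/
def weight (I : CoverInstance n h) (S : Finset (Fin n)) : ℝ := ∑ i ∈ S, I.w i

/-- `S` satisfies all covering constraints. -/
def Feasible (I : CoverInstance n h) (S : Finset (Fin n)) : Prop := ∀ j, 1 ≤ I.f j S

/-- The optimum value; the minimum weight of a feasible set whenever there is one. -/
noncomputable def opt (I : CoverInstance n h) : ℝ := sInf (I.weight '' {S | I.Feasible S})

/-- Element `i` is active in constraint `j`. -/
def Active (I : CoverInstance n h) (i : Fin n) (j : Fin h) : Prop := 0 < I.f j {i}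

/-- Every element is active in at most `r` constraints. -/
def IsSparse (I : CoverInstance n h) (r : ℕ) : Prop :=
  ∀ i, {j | I.Active i j}.ncard ≤ r

end CoverInstance

/-! ### Randomized algorithms: a real random access machine with a value oracle

A program is a fixed structured program. It works on arrays of natural numbers (used as indices and
flags) and arrays of real numbers, all infinite and named by numerals that occur in the program. The
operations on natural numbers are addition and truncated subtraction, those on real numbers are the
four arithmetic operations and exact comparison, there is no rounding, and the only real constants
are rational. Every command, every oracle query and every coin flip costs one step; since
the expressions of a fixed program have bounded size, this counts elementary operations up to a
constant factor. -/

namespace OracleRAM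

/-- Expressions with values in the natural numbers; `get a e` reads cell `e` of array `a`. -/
inductive NatExp : Type
  | const (k : ℕ)
  | get (a : ℕ) (e : NatExp)
  | add (e₁ e₂ : NatExp)
  | sub (e₁ e₂ : NatExp)

/-- Expressions with real values; `get a e` reads cell `e` of array `a`. -/
inductive RealExp : Type
  | const (q : ℚ)
  | ofNat (e : NatExp)
  | get (a : ℕ) (e : NatExp)
  | add (x y : RealExp)
  | sub (x y : RealExp)
  | mul (x y : RealExp)
  | div (x y : RealExp)

/-- Tests. -/
inductive Test : Type
  | natLe (e₁ e₂ : NatExp)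
  | realLe (x y : RealExp)
  | not (t : Test)
  | and (t₁ t₂ : Test)

/-- Programs.
* `setNat a e v`, `setReal a e x`: store a value in cell `e` of array `a`;
* `query a e j b`: store in cell `e` of the real array `a` the oracle's answer to the query `(j, S)`,
  where `S` is the set of all elements `i` whose cell in the array `b` of natural numbers is not 0;
* `flip a e`: store a fair random bit in cell `e` of the array `a` of natural numbers;
* `loop t c`: while `t` holds, do `c`. -/
inductive Prog : Type
  | setNat (a : ℕ) (e v : NatExp)
  | setReal (a : ℕ) (e : NatExp) (x : RealExp)
  | query (a : ℕ) (e j : NatExp) (b : ℕ)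
  | flip (a : ℕ) (e : NatExp)
  | seq (c₁ c₂ : Prog)
  | ite (t : Test) (c₁ c₂ : Prog)
  | loop (t : Test) (c : Prog)

/-- The contents of the memory. -/
structure Memory where
  nat : ℕ → ℕ → ℕ
  real : ℕ → ℕ → ℝ

/-- Write `v` into cell `i` of the array `a` of natural numbers. -/
def Memory.writeNat (m : Memory) (a i v : ℕ) : Memory :=
  { m with nat := Function.update m.nat a (Function.update (m.nat a) i v) }

/-- Write `x` into cell `i` of the real array `a`. -/
noncomputable def Memory.writeReal (m : Memory) (a i : ℕ) (x : ℝ) : Memory :=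
  { m with real := Function.update m.real a (Function.update (m.real a) i x) }

/-- The subset of `Fin n` stored, as a list of flags, in the array `b` of natural numbers. -/
def Memory.set (m : Memory) (n b : ℕ) : Finset (Fin n) :=
  Finset.univ.filter fun i => m.nat b i ≠ 0

/-- The value of an expression. -/
def NatExp.eval (m : Memory) : NatExp → ℕ
  | const k => k
  | get a e => m.nat a (e.eval m)
  | add e₁ e₂ => e₁.eval m + e₂.eval m
  | sub e₁ e₂ => e₁.eval m - e₂.eval m

/-- The value of an expression. -/
noncomputable def RealExp.eval (m : Memory) : RealExp → ℝ
  | const q => (q : ℝ)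
  | ofNat e => (e.eval m : ℝ)
  | get a e => m.real a (e.eval m)
  | add x y => x.eval m + y.eval m
  | sub x y => x.eval m - y.eval m
  | mul x y => x.eval m * y.eval m
  | div x y => x.eval m / y.eval m

/-- Whether a test holds. -/
def Test.Holds (m : Memory) : Test → Prop
  | natLe e₁ e₂ => e₁.eval m ≤ e₂.eval m
  | realLe x y => x.eval m ≤ y.eval m
  | not t => ¬ t.Holds m
  | and t₁ t₂ => t₁.Holds m ∧ t₂.Holds m

/-- A configuration: the commands that are still to be executed, and the memory. -/
structure Config where
  todo : List Prog
  mem : Memory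

/-- The answer of the value oracle to a query `(j, S)`; a query about a constraint that does not
exist is answered by 0. -/
def oracleAnswer {n h : ℕ} (f : Fin h → Finset (Fin n) → ℝ) (j : ℕ) (S : Finset (Fin n)) : ℝ :=
  if hj : j < h then f ⟨j, hj⟩ S else 0

open Classical in
/-- One step of the machine with the value oracle `f`, as a distribution over next configurations.
A configuration with nothing left to execute has halted and does not change any more. -/
noncomputable def step {n h : ℕ} (f : Fin h → Finset (Fin n) → ℝ) : Config → PMF Config
  | ⟨[], m⟩ => PMF.pure ⟨[], m⟩
  | ⟨Prog.setNat a e v :: k, m⟩ => PMF.pure ⟨k, m.writeNat a (e.eval m) (v.eval m)⟩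
  | ⟨Prog.setReal a e x :: k, m⟩ => PMF.pure ⟨k, m.writeReal a (e.eval m) (x.eval m)⟩
  | ⟨Prog.query a e j b :: k, m⟩ =>
      PMF.pure ⟨k, m.writeReal a (e.eval m) (oracleAnswer f (j.eval m) (m.set n b))⟩
  | ⟨Prog.flip a e :: k, m⟩ =>
      (PMF.uniformOfFintype Bool).map fun c => ⟨k, m.writeNat a (e.eval m) c.toNat⟩
  | ⟨Prog.seq c₁ c₂ :: k, m⟩ => PMF.pure ⟨c₁ :: c₂ :: k, m⟩
  | ⟨Prog.ite t c₁ c₂ :: k, m⟩ => PMF.pure ⟨(if t.Holds m then c₁ else c₂) :: k, m⟩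
  | ⟨Prog.loop t c :: k, m⟩ =>
      PMF.pure ⟨if t.Holds m then c :: Prog.loop t c :: k else k, m⟩

/-- The distribution of the configuration after `T` steps from configuration `c`. -/
noncomputable def run {n h : ℕ} (f : Fin h → Finset (Fin n) → ℝ) : ℕ → Config → PMF Config
  | 0, c => PMF.pure c
  | T + 1, c => (step f c).bind (run f T)

/-- The memory at the start: `n` and `h` in cells 0 and 1 of array 0 of natural numbers, `ε` in cell
0 of the real array 0, the weights in the real array 1, and 0 everywhere else. -/
noncomputable def inputMemory {n h : ℕ} (w : Fin n → ℝ) (ε : ℝ) : Memory where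
  nat a i := if a = 0 ∧ i = 0 then n else if a = 0 ∧ i = 1 then h else 0
  real a i := if a = 0 ∧ i = 0 then ε else if hi : a = 1 ∧ i < n then w ⟨i, hi.2⟩ else 0

/-- The distribution of the configuration of the program `P` after `T` steps, when started on the
instance `I` (with its functions accessible only through the value oracle) and the number `ε`. -/
noncomputable def execute {n h : ℕ} (P : Prog) (I : CoverInstance n h) (ε : ℝ) (T : ℕ) :
    PMF Config :=
  run I.f T ⟨[P], inputMemory (h := h) I.w ε⟩

/-- For all outcomes of the coin flips, `P` halts within `T` steps. -/
def HaltsWithin {n h : ℕ} (P : Prog) (I : CoverInstance n h) (ε : ℝ) (T : ℕ) : Prop :=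
  ∀ c ∈ (execute P I ε T).support, c.todo = []

/-- The distribution of the output, the set stored in array 1 of natural numbers after `T` steps.
If `P` halts within `T` steps, it does not depend on `T` any more. -/
noncomputable def output {n h : ℕ} (P : Prog) (I : CoverInstance n h) (ε : ℝ) (T : ℕ) :
    PMF (Finset (Fin n)) :=
  (execute P I ε T).map fun c => c.mem.set n 1

end OracleRAM

/-- The expected weight of a random set. -/
noncomputable def CoverInstance.expectedWeight {n h : ℕ} (I : CoverInstance n h)
    (μ : PMF (Finset (Fin n))) : ℝ :=
  ∑ S, (μ S).toReal * I.weight S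

/-! A deterministic greedy algorithm suffices, and `ε` is only compared with 1. If `ε ≥ 1`, the
coverage required is negative, so the empty set works. Otherwise every constraint is covered to
level `2/3`, which exceeds `1 - 1/e` because `e < 3`; since `1/ε > 1`, weight at most `12 ln r ·
OPT` is enough.

The greedy rule is applied to a capped deficit `∑ c_j (1 - min 1 f_j)`, which is antitone and
supermodular. Some element therefore decreases it, per unit of weight, by at least the deficit
divided by the weight of any set that brings it to zero. For one constraint `j`, stopping at deficit
`1/3` costs at most three times the weight of any cover of `j` (`singleSet_spec`). The active part
of an optimal set is such a cover, so `r`-sparsity bounds the sum of these single costs by `3 r ·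
OPT` (`sum_singleCost_le`).

A second greedy run uses the single costs as coefficients `c_j` and stops once no element removes
more than one unit of deficit per unit of weight. The deficit falls from at most `3 r · OPT` to at
most `OPT`, at a price of order `ln r · OPT` (`jointSet_spec`). Each constraint still below `2/3` is
then repaired by its single solution; its cost is at most three times its share of the remaining
deficit, so repair costs at most `3 · OPT` (`weight_repairSet_le`).

The rest is program verification: a total-correctness calculus with step counts shows that a
concrete program computes exactly these sets in polynomial time (`coverProg_spec`, `coverTime_le`).
-/

namespace OracleRAM

/-! ### Step-counting correctness calculus for programs without coin flips -/

variable {n h : ℕ} {f : Fin h → Finset (Fin n) → ℝ}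

/-- From memory `m`, the program `P` surely ends in memory `m'` after `t` steps. -/
def Runs (f : Fin h → Finset (Fin n) → ℝ) (P : Prog) (m m' : Memory) (t : ℕ) : Prop :=
  ∀ k T, run f (T + t) ⟨P :: k, m⟩ = run f T ⟨k, m'⟩

/-- From memory `m`, the program `P` surely halts within `B` steps, in a memory satisfying `Q`. -/
def WP (f : Fin h → Finset (Fin n) → ℝ) (P : Prog) (B : ℕ) (Q : Memory → Prop) (m : Memory) : Prop :=
  ∃ m' t, t ≤ B ∧ Runs f P m m' t ∧ Q m'

theorem WP.mono {P : Prog} {B B' : ℕ} {Q Q' : Memory → Prop} {m : Memory}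
    (hw : WP f P B Q m) (hB : B ≤ B') (hQ : ∀ m', Q m' → Q' m') : WP f P B' Q' m := by
  obtain ⟨m', t, ht, hr, hq⟩ := hw
  exact ⟨m', t, ht.trans hB, hr, hQ _ hq⟩

theorem WP.setNat {a : ℕ} {e v : NatExp} {Q : Memory → Prop} {m : Memory}
    (hq : Q (m.writeNat a (e.eval m) (v.eval m))) : WP f (.setNat a e v) 1 Q m :=
  ⟨_, 1, le_rfl, fun k T => by simp [run, step], hq⟩

theorem WP.setReal {a : ℕ} {e : NatExp} {x : RealExp} {Q : Memory → Prop} {m : Memory}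
    (hq : Q (m.writeReal a (e.eval m) (x.eval m))) : WP f (.setReal a e x) 1 Q m :=
  ⟨_, 1, le_rfl, fun k T => by simp [run, step], hq⟩

theorem WP.query {a b : ℕ} {e j : NatExp} {Q : Memory → Prop} {m : Memory}
    (hq : Q (m.writeReal a (e.eval m) (oracleAnswer f (j.eval m) (m.set n b)))) :
    WP f (.query a e j b) 1 Q m :=
  ⟨_, 1, le_rfl, fun k T => by simp [run, step], hq⟩

theorem WP.seq {P₁ P₂ : Prog} {B₁ B₂ : ℕ} {Q : Memory → Prop} {m : Memory}
    (hw : WP f P₁ B₁ (WP f P₂ B₂ Q) m) : WP f (.seq P₁ P₂) (B₁ + B₂ + 1) Q m := by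
  obtain ⟨m₁, t₁, h₁, r₁, m₂, t₂, h₂, r₂, hq⟩ := hw
  refine ⟨m₂, t₁ + t₂ + 1, by omega, fun k T => ?_, hq⟩
  have : T + (t₁ + t₂ + 1) = (T + t₂ + t₁) + 1 := by ring
  rw [this]
  simp only [run, step, PMF.pure_bind]
  rw [r₁, r₂]

theorem WP.ite {t : Test} {P₁ P₂ : Prog} {B : ℕ} {Q : Memory → Prop} {m : Memory}
    (h₁ : t.Holds m → WP f P₁ B Q m) (h₂ : ¬ t.Holds m → WP f P₂ B Q m) :
    WP f (.ite t P₁ P₂) (B + 1) Q m := by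
  by_cases ht : t.Holds m
  · obtain ⟨m', s, hs, r, hq⟩ := h₁ ht
    refine ⟨m', s + 1, by omega, fun k T => ?_, hq⟩
    rw [← add_assoc]
    simp only [run, step, PMF.pure_bind, if_pos ht]
    rw [r]
  · obtain ⟨m', s, hs, r, hq⟩ := h₂ ht
    refine ⟨m', s + 1, by omega, fun k T => ?_, hq⟩
    rw [← add_assoc]
    simp only [run, step, PMF.pure_bind, if_neg ht]
    rw [r]

/-- The number stored in cell 0 of the array `a`. -/
abbrev natVar (a : ℕ) : NatExp := .get a (.const 0)

/-- The real number stored in cell 0 of the array `a`. -/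
abbrev realVar (a : ℕ) : RealExp := .get a (.const 0)

/-- A command without effect on the arrays that matter. -/
def Prog.skip : Prog := .setReal 20 (.const 0) (.const 0)

/-- `for a := 0, …, e - 1 do P`, with the loop index in cell 0 of array `a`. -/
def Prog.forLoop (a : ℕ) (e : NatExp) (P : Prog) : Prog :=
  .seq (.setNat a (.const 0) (.const 0))
    (.loop (.not (.natLe e (natVar a)))
      (.seq P (.setNat a (.const 0) (.add (natVar a) (.const 1)))))

theorem Runs.loop_end {t : Test} {P : Prog} {m : Memory} (ht : ¬ t.Holds m) :
    Runs f (.loop t P) m m 1 := fun k T => by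
  simp [run, step, ht]

theorem Runs.loop_step {t : Test} {P : Prog} {m m₁ m₂ : Memory} {s₁ s₂ : ℕ} (ht : t.Holds m)
    (r₁ : Runs f P m m₁ s₁) (r₂ : Runs f (.loop t P) m₁ m₂ s₂) :
    Runs f (.loop t P) m m₂ (s₁ + s₂ + 1) := fun k T => by
  have : T + (s₁ + s₂ + 1) = (T + s₂ + s₁) + 1 := by ring
  rw [this]
  simp only [run, step, PMF.pure_bind, if_pos ht]
  rw [r₁, r₂]

/-- `Inv i` is stated for memories whose counter already equals `i`, so the body must establish `Inv
(i + 1)` for the memory after the increment. Each round costs three steps besides the body: the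
test, the sequencing and the increment. -/
theorem WP.forLoop {a N B : ℕ} {e : NatExp} {P : Prog} (Inv : ℕ → Memory → Prop) {m : Memory}
    (h0 : Inv 0 (m.writeNat a 0 0))
    (he : ∀ i m, Inv i m → e.eval m = N)
    (hstep : ∀ i m, i < N → m.nat a 0 = i → Inv i m →
      WP f P B (fun m' => m'.nat a 0 = i ∧ Inv (i + 1) (m'.writeNat a 0 (i + 1))) m) :
    WP f (.forLoop a e P) (N * (B + 3) + 3) (Inv N) m := by
  have key : ∀ k i m, i + k = N → m.nat a 0 = i → Inv i m →
      WP f (.loop (.not (.natLe e (natVar a)))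
        (.seq P (.setNat a (.const 0) (.add (natVar a) (.const 1))))) (k * (B + 3) + 1) (Inv N) m := by
    intro k
    induction k with
    | zero =>
      intro i m hi hm hI
      refine ⟨m, 1, by omega, Runs.loop_end ?_, by simpa [← hi] using hI⟩
      simp [Test.Holds, he i m hI, NatExp.eval, hm, ← hi]
    | succ k ih =>
      intro i m hi hm hI
      have hlt : i < N := by omega
      have hb : WP f (.seq P (.setNat a (.const 0) (.add (natVar a) (.const 1)))) (B + 1 + 1)
          (fun m' => m'.nat a 0 = i + 1 ∧ Inv (i + 1) m') m := by
        refine WP.seq ((hstep i m hlt hm hI).mono le_rfl ?_)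
        rintro m' ⟨h1, h2⟩
        refine WP.setNat ?_
        simp only [NatExp.eval, h1]
        exact ⟨by simp [Memory.writeNat], h2⟩
      obtain ⟨m₁, s₁, hs₁, r₁, hm₁, hI₁⟩ := hb
      obtain ⟨m₂, s₂, hs₂, r₂, hq⟩ := ih (i + 1) m₁ (by omega) hm₁ hI₁
      refine ⟨m₂, s₁ + s₂ + 1, ?_, Runs.loop_step ?_ r₁ r₂, hq⟩
      · rw [Nat.succ_mul]; omega
      · simp [Test.Holds, he i m hI, NatExp.eval, hm, hlt]
  refine (WP.seq (B₂ := N * (B + 3) + 1) (WP.setNat ?_)).mono (by omega) fun _ => id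
  simp only [NatExp.eval]
  exact key N 0 _ (by simp) (by simp [Memory.writeNat]) h0

/-! ### Framing: each routine leaves the low-numbered arrays unchanged -/

/-- The arrays with numbers below `L` are the same in both memories. -/
def Same (L : ℕ) (m m' : Memory) : Prop := ∀ a < L, m'.nat a = m.nat a ∧ m'.real a = m.real a

theorem Same.refl (L : ℕ) (m : Memory) : Same L m m := fun _ _ => ⟨rfl, rfl⟩

theorem Same.trans {L : ℕ} {m m' m'' : Memory} (h₁ : Same L m m') (h₂ : Same L m' m'') :
    Same L m m'' := fun a ha =>
  ⟨(h₂ a ha).1.trans (h₁ a ha).1, (h₂ a ha).2.trans (h₁ a ha).2⟩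

theorem Same.mono {L L' : ℕ} {m m' : Memory} (hs : Same L m m') (hL : L' ≤ L) : Same L' m m' :=
  fun a ha => hs a (ha.trans_le hL)

theorem Same.writeNat {L a i v : ℕ} {m m' : Memory} (hs : Same L m m') (ha : L ≤ a) :
    Same L m (m'.writeNat a i v) := fun b hb =>
  ⟨by simpa [Memory.writeNat, Function.update_of_ne (show b ≠ a by omega)] using (hs b hb).1,
    (hs b hb).2⟩

theorem Same.writeReal {L a i : ℕ} {x : ℝ} {m m' : Memory} (hs : Same L m m') (ha : L ≤ a) :
    Same L m (m'.writeReal a i x) := fun b hb =>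
  ⟨(hs b hb).1,
    by simpa [Memory.writeReal, Function.update_of_ne (show b ≠ a by omega)] using (hs b hb).2⟩

theorem Memory.set_congr {m m' : Memory} {b : ℕ} (hb : m'.nat b = m.nat b) :
    m'.set n b = m.set n b := by
  simp [Memory.set, hb]

theorem Memory.mem_set {m : Memory} {b : ℕ} {i : Fin n} : i ∈ m.set n b ↔ m.nat b i ≠ 0 := by
  simp [Memory.set]

theorem Same.set {L b : ℕ} {m m' : Memory} (hs : Same L m m') (hb : b < L) :
    m'.set n b = m.set n b := Memory.set_congr (hs b hb).1

end OracleRAM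
/-! ### Greedy covering -/

namespace Greedy

variable {n : ℕ}

/-- The element `b`, if there is one with that number, added to a set. -/
def insertNat (b : ℕ) (S : Finset (Fin n)) : Finset (Fin n) :=
  if hb : b < n then insert ⟨b, hb⟩ S else S

/-- The decrease of the deficit `D` per unit of weight when `x` is added to `S`. -/
noncomputable def ratio (D : Finset (Fin n) → ℝ) (w : Fin n → ℝ) (S : Finset (Fin n)) (x : Fin n) :
    ℝ := (D S - D (insert x S)) / w x

open Classical in
/-- The largest ratio above `l` among the first elements outside `S`, and an element attaining it
(`l` and `n` if there is none). -/
noncomputable def probe (D : Finset (Fin n) → ℝ) (w : Fin n → ℝ) (l : ℝ) (S : Finset (Fin n)) :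
    ℕ → ℝ × ℕ
  | 0 => (l, n)
  | i + 1 =>
    if hi : i < n then
      if ⟨i, hi⟩ ∉ S ∧ (probe D w l S i).1 < ratio D w S ⟨i, hi⟩ then (ratio D w S ⟨i, hi⟩, i)
      else probe D w l S i
    else probe D w l S i

open Classical in
/-- Add an element with the largest ratio, provided that this ratio exceeds `l` and that the deficit
exceeds `d`. -/
noncomputable def greedyStep (D : Finset (Fin n) → ℝ) (w : Fin n → ℝ) (d l : ℝ)
    (S : Finset (Fin n)) : Finset (Fin n) :=
  if D S ≤ d then S else insertNat (probe D w l S n).2 S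

open Classical in
/-- The elements without weight. -/
noncomputable def nullSet (w : Fin n → ℝ) : Finset (Fin n) := Finset.univ.filter fun i => w i ≤ 0

/-- The result of the greedy algorithm. -/
noncomputable def greedySet (D : Finset (Fin n) → ℝ) (w : Fin n → ℝ) (d l : ℝ) : Finset (Fin n) :=
  (greedyStep D w d l)^[n] (nullSet w)

/-- Non-negative, antitone, supermodular functions that the set `O` reduces to zero. -/
structure IsDeficit (D : Finset (Fin n) → ℝ) (w : Fin n → ℝ) (O : Finset (Fin n)) : Prop where
  nonneg : ∀ S, 0 ≤ D S
  anti : Antitone D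
  super : ∀ x S T, S ⊆ T → D T - D (insert x T) ≤ D S - D (insert x S)
  zero : D O = 0
  w_nonneg : ∀ i, 0 ≤ w i

variable {D : Finset (Fin n) → ℝ} {w : Fin n → ℝ} {d l : ℝ} {O S : Finset (Fin n)}

/-- The running maximum starts at the threshold `l`, so the sentinel `(l, n)` survives exactly when
no element inspected beats `l`. In both cases the first component bounds all ratios inspected so
far. -/
theorem probe_spec (i : ℕ) (hi : i ≤ n) :
    ((probe D w l S i = (l, n)) ∨
      ∃ x : Fin n, x ∉ S ∧ l < ratio D w S x ∧ probe D w l S i = (ratio D w S x, (x : ℕ))) ∧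
    ∀ x : Fin n, (x : ℕ) < i → x ∉ S → ratio D w S x ≤ (probe D w l S i).1 := by
  induction i with
  | zero => simp [probe]
  | succ i ih =>
    obtain ⟨h1, h2⟩ := ih (by omega)
    have hl : l ≤ (probe D w l S i).1 := by
      rcases h1 with h1 | ⟨x, -, hx, h1⟩ <;> rw [h1]
      exact hx.le
    have hin : i < n := hi
    simp only [probe, hin, dif_pos]
    split_ifs with hc
    · refine ⟨Or.inr ⟨⟨i, hin⟩, hc.1, hl.trans_lt hc.2, rfl⟩, fun x hx hxS => ?_⟩
      rcases Nat.lt_succ_iff_lt_or_eq.1 hx with hx | hx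
      · exact (h2 x hx hxS).trans hc.2.le
      · have : x = ⟨i, hin⟩ := Fin.ext hx
        rw [this]
    · refine ⟨h1, fun x hx hxS => ?_⟩
      rcases Nat.lt_succ_iff_lt_or_eq.1 hx with hx | hx
      · exact h2 x hx hxS
      · have : x = ⟨i, hin⟩ := Fin.ext hx
        rw [this] at hxS ⊢
        by_contra hlt
        exact hc ⟨hxS, not_le.1 hlt⟩

namespace IsDeficit

/-- Add the elements of `A` one at a time; by supermodularity each decrease is at most the one it
would cause at `S` itself. -/
theorem sub_union_le (hD : IsDeficit D w O) (S A : Finset (Fin n)) :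
    D S - D (S ∪ A) ≤ ∑ x ∈ A, (D S - D (insert x S)) := by
  induction A using Finset.induction_on with
  | empty => simp
  | insert a A ha ih =>
    rw [Finset.sum_insert ha, Finset.union_insert]
    have := hD.super a S (S ∪ A) Finset.subset_union_left
    linarith

/-- Adding all of `O` removes the whole deficit, while each of its elements removes at most `p`
times its weight. Weightless elements already lie in `S`, so no ratio divides by zero. -/
theorem le_of_ratio_le (hD : IsDeficit D w O) {p : ℝ} (hp : 0 ≤ p) (hS : nullSet w ⊆ S)
    (hr : ∀ x, x ∉ S → ratio D w S x ≤ p) : D S ≤ p * ∑ i ∈ O, w i := by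
  have h1 := hD.sub_union_le S O
  have h2 : D (S ∪ O) ≤ 0 := hD.zero ▸ hD.anti Finset.subset_union_right
  have h3 : ∑ x ∈ O, (D S - D (insert x S)) ≤ ∑ x ∈ O, p * w x := by
    refine Finset.sum_le_sum fun x _ => ?_
    by_cases hx : x ∈ S
    · rw [Finset.insert_eq_of_mem hx, sub_self]
      exact mul_nonneg hp (hD.w_nonneg x)
    · have hw : 0 < w x := by
        by_contra hw
        exact hx (hS (by simpa [nullSet] using hw))
      exact (div_le_iff₀ hw).1 (hr x hx)
  rw [Finset.mul_sum]
  linarith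

/-- A chosen element satisfies two inequalities: its ratio is maximal, hence at least the deficit
over the weight of `O`, and it exceeds `l`. If nothing is chosen, `l` bounds all ratios and thus the
deficit. -/
theorem step (hD : IsDeficit D w O) (hl : 0 ≤ l) (hS : nullSet w ⊆ S) :
    (greedyStep D w d l S = S ∧ (D S ≤ d ∨ D S ≤ l * ∑ i ∈ O, w i)) ∨
    ∃ x ∉ S, greedyStep D w d l S = insert x S ∧ d < D S ∧
      w x * D S ≤ (∑ i ∈ O, w i) * (D S - D (insert x S)) ∧ l * w x ≤ D S - D (insert x S) := by
  unfold greedyStep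
  split_ifs with hd
  · exact Or.inl ⟨rfl, Or.inl hd⟩
  obtain ⟨h1, h2⟩ := probe_spec (D := D) (w := w) (l := l) (S := S) n le_rfl
  rcases h1 with h1 | ⟨x, hx, hlx, h1⟩
  · refine Or.inl ⟨by simp [h1, insertNat], Or.inr (hD.le_of_ratio_le hl hS fun x hx => ?_)⟩
    simpa [h1] using h2 x x.2 hx
  · have hw : 0 < w x := by
      by_contra hw
      exact hx (hS (by simpa [nullSet] using hw))
    refine Or.inr ⟨x, hx, by simp [h1, insertNat], not_le.1 hd, ?_, ((lt_div_iff₀ hw).1 hlx).le⟩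
    have h3 := hD.le_of_ratio_le (hl.trans hlx.le) hS fun y hy => by
      simpa [h1] using h2 y y.2 hy
    calc w x * D S ≤ w x * (ratio D w S x * ∑ i ∈ O, w i) := by gcongr
      _ = (∑ i ∈ O, w i) * (D S - D (insert x S)) := by
        unfold ratio; field_simp

/-- `P` is an arbitrary invariant, instantiated later by a potential-function bound on the weight.
The stopping conditions persist because `D` is antitone, and a round that does not stop enlarges the
set, so `n` rounds suffice. -/
theorem greedySet_spec (hD : IsDeficit D w O) (hl : 0 ≤ l) (P : Finset (Fin n) → Prop)
    (h0 : P (nullSet w))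
    (hP : ∀ S x, x ∉ S → P S → d < D S →
      w x * D S ≤ (∑ i ∈ O, w i) * (D S - D (insert x S)) → l * w x ≤ D S - D (insert x S) →
      P (insert x S)) :
    P (greedySet D w d l) ∧
      (D (greedySet D w d l) ≤ d ∨ D (greedySet D w d l) ≤ l * ∑ i ∈ O, w i) := by
  have key : ∀ k, P ((greedyStep D w d l)^[k] (nullSet w)) ∧
      nullSet w ⊆ (greedyStep D w d l)^[k] (nullSet w) ∧
      ((D ((greedyStep D w d l)^[k] (nullSet w)) ≤ d ∨
        D ((greedyStep D w d l)^[k] (nullSet w)) ≤ l * ∑ i ∈ O, w i) ∨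
        k ≤ ((greedyStep D w d l)^[k] (nullSet w)).card) := by
    intro k
    induction k with
    | zero => exact ⟨h0, subset_rfl, Or.inr (Nat.zero_le _)⟩
    | succ k ih =>
      rw [Function.iterate_succ_apply']
      set S := (greedyStep D w d l)^[k] (nullSet w)
      obtain ⟨i1, i2, i3⟩ := ih
      rcases hD.step (d := d) hl i2 with ⟨e, hs⟩ | ⟨x, hx, e, s1, s2, s3⟩
      · rw [e]; exact ⟨i1, i2, Or.inl hs⟩
      · rw [e]
        refine ⟨hP S x hx i1 s1 s2 s3, i2.trans (Finset.subset_insert x S), ?_⟩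
        rcases i3 with i3 | i3
        · have ha := hD.anti (Finset.subset_insert x S)
          exact Or.inl (i3.imp ha.trans ha.trans)
        · right
          rw [Finset.card_insert_of_notMem hx]; omega
  obtain ⟨k1, k2, k3⟩ := key n
  -- If no stop was recorded, the set has `n` elements, so it is everything and one more round
  -- cannot add an element.
  refine ⟨k1, k3.elim id fun hc => ?_⟩
  rcases hD.step (d := d) hl k2 with ⟨_, hs⟩ | ⟨x, hx, _⟩
  · exact hs
  · have : (greedyStep D w d l)^[n] (nullSet w) = Finset.univ := by
      rw [← Finset.card_eq_iff_eq_univ, Fintype.card_fin]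
      exact le_antisymm ((Finset.card_le_univ _).trans (by simp)) hc
    exact absurd (this ▸ Finset.mem_univ x) hx

end IsDeficit

end Greedy
-- The approximation guarantee
namespace CoverInstance

open OracleRAM Greedy

variable {n h : ℕ}

/-- The total shortage of `S` in all constraints, with coefficients `c`. -/
noncomputable def deficit (f : Fin h → Finset (Fin n) → ℝ) (c : ℕ → ℝ) (S : Finset (Fin n)) : ℝ :=
  ∑ j ∈ Finset.range h, c j * (1 - min 1 (oracleAnswer f j S))

/-- The coefficients that select one constraint. -/
noncomputable def unitCoeff (j : ℕ) : ℕ → ℝ := Function.update (fun _ => 0) j 1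

/-- The greedy solution for a single constraint. -/
noncomputable def singleSet (f : Fin h → Finset (Fin n) → ℝ) (w : Fin n → ℝ) (j : ℕ) :
    Finset (Fin n) := greedySet (deficit f (unitCoeff j)) w (1 / 3) 0

/-- The weight of the greedy solution for a single constraint. -/
noncomputable def singleCost (f : Fin h → Finset (Fin n) → ℝ) (w : Fin n → ℝ) (j : ℕ) : ℝ :=
  ∑ i ∈ singleSet f w j, w i

/-- The greedy solution for all constraints together, weighted by their individual costs. -/
noncomputable def jointSet (f : Fin h → Finset (Fin n) → ℝ) (w : Fin n → ℝ) : Finset (Fin n) :=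
  greedySet (deficit f (singleCost f w)) w 0 1

open Classical in
/-- The joint greedy solution, extended by the individual solutions for those of the first
constraints that are not yet satisfied. -/
noncomputable def repairSet (f : Fin h → Finset (Fin n) → ℝ) (w : Fin n → ℝ) : ℕ → Finset (Fin n)
  | 0 => jointSet f w
  | j + 1 => if 2 / 3 ≤ oracleAnswer f j (repairSet f w j) then repairSet f w j
      else repairSet f w j ∪ singleSet f w j

theorem deficit_congr {f : Fin h → Finset (Fin n) → ℝ} {c c' : ℕ → ℝ} (hc : ∀ j < h, c j = c' j) :
    deficit f c = deficit f c' :=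
  funext fun _ => Finset.sum_congr rfl fun j hj => by rw [hc j (Finset.mem_range.1 hj)]

theorem deficit_unitCoeff {f : Fin h → Finset (Fin n) → ℝ} {j : ℕ} (hj : j < h)
    (S : Finset (Fin n)) : deficit f (unitCoeff j) S = 1 - min 1 (oracleAnswer f j S) := by
  unfold deficit
  rw [Finset.sum_eq_single_of_mem j (Finset.mem_range.2 hj)]
  · simp [unitCoeff]
  · intro i _ hi
    simp [unitCoeff, Function.update_of_ne hi]

/-- The cap `min 1` is monotone and concave: an increment that is no longer and starts no lower
stays no larger after capping. -/
theorem min_one_sub_le {a b c d : ℝ} (h1 : a ≤ b) (h2 : a ≤ c) (h3 : b ≤ d) (h4 : c ≤ d)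
    (h5 : d - c ≤ b - a) : min 1 d - min 1 c ≤ min 1 b - min 1 a := by
  simp only [min_def]
  split_ifs <;> linarith

variable (I : CoverInstance n h)

/-- `O` has to cover only the constraints with a nonzero coefficient, so the same lemma serves the
single and the joint runs. -/
theorem isDeficit {c : ℕ → ℝ} (hc : ∀ j, 0 ≤ c j) {O : Finset (Fin n)}
    (hO : ∀ j < h, c j ≠ 0 → 1 ≤ oracleAnswer I.f j O) : IsDeficit (deficit I.f c) I.w O where
  nonneg S := Finset.sum_nonneg fun j _ =>
    mul_nonneg (hc j) (sub_nonneg.2 (min_le_left _ _))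
  anti S T hST := by
    refine Finset.sum_le_sum fun j hj => mul_le_mul_of_nonneg_left ?_ (hc j)
    have hj := Finset.mem_range.1 hj
    simp only [oracleAnswer, hj, dif_pos]
    have := min_le_min_left 1 (I.f_mono ⟨j, hj⟩ hST)
    linarith
  super x S T hST := by
    unfold deficit
    rw [← Finset.sum_sub_distrib, ← Finset.sum_sub_distrib]
    refine Finset.sum_le_sum fun j hj => ?_
    rw [← mul_sub, ← mul_sub]
    refine mul_le_mul_of_nonneg_left ?_ (hc j)
    have hj := Finset.mem_range.1 hj
    simp only [oracleAnswer, hj, dif_pos]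
    set g := I.f ⟨j, hj⟩
    have m := I.f_mono ⟨j, hj⟩
    have h1 : g (insert x S ∪ T) + g (insert x S ∩ T) ≤ g (insert x S) + g T :=
      I.f_submodular ⟨j, hj⟩ _ _
    have h2 : insert x S ∪ T = insert x T := by
      rw [Finset.insert_union, Finset.union_eq_right.2 hST]
    have h3 : g S ≤ g (insert x S ∩ T) :=
      m (Finset.subset_inter (Finset.subset_insert _ _) hST)
    rw [h2] at h1
    have := min_one_sub_le (m (Finset.subset_insert x S)) (m hST)
      (m (Finset.insert_subset_insert x hST)) (m (Finset.subset_insert x T))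
      (show g (insert x T) - g T ≤ g (insert x S) - g S by linarith)
    linarith
  zero := Finset.sum_eq_zero fun j hj => by
    by_cases h0 : c j = 0
    · simp [h0]
    · simp [hO j (Finset.mem_range.1 hj) h0]
  w_nonneg := I.w_nonneg

theorem sum_nullSet : ∑ i ∈ nullSet I.w, I.w i = 0 :=
  Finset.sum_eq_zero fun i hi => le_antisymm (by simpa [nullSet] using hi) (I.w_nonneg i)

theorem unitCoeff_nonneg (j k : ℕ) : 0 ≤ unitCoeff j k := by
  by_cases hk : k = j
  · simp [unitCoeff, hk]
  · simp [unitCoeff, Function.update_of_ne hk]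

theorem oracleAnswer_mono {j : ℕ} {S T : Finset (Fin n)} (hST : S ⊆ T) :
    oracleAnswer I.f j S ≤ oracleAnswer I.f j T := by
  unfold oracleAnswer
  split_ifs
  · exact I.f_mono _ hST
  · exact le_rfl

/-- While the deficit exceeds `1/3`, an added element of weight `w x` removes at least `w x / 3` of
the deficit times the weight of `A`. Hence weight plus `3 * I.weight A` times the deficit never
increases. -/
theorem singleSet_spec {j : ℕ} (hj : j < h) {A : Finset (Fin n)} (hA : 1 ≤ oracleAnswer I.f j A) :
    singleCost I.f I.w j ≤ 3 * I.weight A ∧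
      2 / 3 ≤ oracleAnswer I.f j (singleSet I.f I.w j) := by
  have hD : IsDeficit (deficit I.f (unitCoeff j)) I.w A := by
    refine I.isDeficit (unitCoeff_nonneg j) fun k _ hk => ?_
    by_cases hkj : k = j
    · exact hkj ▸ hA
    · simp [unitCoeff, Function.update_of_ne hkj] at hk
  have hW : 0 ≤ I.weight A := Finset.sum_nonneg fun i _ => I.w_nonneg i
  have h1 : ∀ S, deficit I.f (unitCoeff j) S ≤ 1 := fun S => by
    rw [deficit_unitCoeff hj]
    have : 0 ≤ min 1 (oracleAnswer I.f j S) := by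
      refine le_min zero_le_one ?_
      simp only [oracleAnswer, hj, dif_pos]
      exact I.f_nonneg _ _
    linarith
  obtain ⟨s1, s2⟩ := hD.greedySet_spec (d := 1 / 3) (l := 0) le_rfl
    (fun S => ∑ i ∈ S, I.w i + 3 * I.weight A * deficit I.f (unitCoeff j) S ≤ 3 * I.weight A)
    (by
      rw [I.sum_nullSet]
      nlinarith [h1 (nullSet I.w)])
    (fun S x hx hP hd hs _ => by
      rw [Finset.sum_insert hx]
      change I.w x * _ ≤ I.weight A * _ at hs
      nlinarith [mul_le_mul_of_nonneg_left hd.le (I.w_nonneg x)])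
  constructor
  · have := mul_nonneg hW (hD.nonneg (greedySet (deficit I.f (unitCoeff j)) I.w (1 / 3) 0))
    simp only [singleCost, singleSet]
    linarith
  · have : deficit I.f (unitCoeff j) (singleSet I.f I.w j) ≤ 1 / 3 := by
      rcases s2 with s2 | s2
      · exact s2
      · exact s2.trans (by norm_num)
    rw [deficit_unitCoeff hj] at this
    have := min_le_right 1 (oracleAnswer I.f j (singleSet I.f I.w j))
    linarith

theorem singleCost_nonneg (j : ℕ) : 0 ≤ singleCost I.f I.w j :=
  Finset.sum_nonneg fun i _ => I.w_nonneg i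

-- By submodularity and non-negativity of the value on the intersection, an inactive element adds
-- nothing to any set, so inactive elements can be dropped one by one.
open Classical in
theorem le_filter_active (j : Fin h) (O : Finset (Fin n)) :
    I.f j O ≤ I.f j (O.filter fun i => I.Active i j) := by
  have key : ∀ B : Finset (Fin n), (∀ i ∈ B, ¬ I.Active i j) → ∀ A, I.f j (A ∪ B) ≤ I.f j A := by
    intro B
    induction B using Finset.induction_on with
    | empty => simp
    | insert b B hb ih =>
      intro hB A
      have h1 := ih (fun i hi => hB i (Finset.mem_insert_of_mem hi)) A
      have h2 := I.f_submodular j (A ∪ B) {b}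
      have h3 := not_lt.1 (hB b (Finset.mem_insert_self b B))
      have h4 := I.f_nonneg j ((A ∪ B) ∩ {b})
      rw [show A ∪ insert b B = A ∪ B ∪ {b} by ext; simp]
      linarith
  have := key (O.filter fun i => ¬ I.Active i j) (by simp) (O.filter fun i => I.Active i j)
  rwa [Finset.filter_union_filter_not_eq] at this

/-- The active part of `O` covers constraint `j` alone. Summed over `j`, every element of `O` is
charged at most `r` times. -/
theorem sum_singleCost_le {r : ℕ} (hr : I.IsSparse r) {O : Finset (Fin n)} (hO : I.Feasible O) :
    ∑ j ∈ Finset.range h, singleCost I.f I.w j ≤ 3 * r * I.weight O := by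
  classical
  rw [Finset.sum_range]
  calc ∑ j : Fin h, singleCost I.f I.w j
      ≤ ∑ j : Fin h, 3 * I.weight (O.filter fun i => I.Active i j) := by
        refine Finset.sum_le_sum fun j _ => (I.singleSet_spec j.2 ?_).1
        simpa [oracleAnswer] using (hO j).trans (I.le_filter_active j O)
    _ = 3 * ∑ i ∈ O, ∑ j : Fin h, if I.Active i j then I.w i else 0 := by
        simp only [weight, Finset.sum_filter]
        rw [← Finset.mul_sum, Finset.sum_comm]
    _ ≤ 3 * ∑ i ∈ O, r * I.w i := by
        gcongr with i _
        rw [← Finset.sum_filter, Finset.sum_const, nsmul_eq_mul]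
        refine mul_le_mul_of_nonneg_right ?_ (I.w_nonneg i)
        have := hr i
        rw [Set.ncard_eq_toFinset_card'] at this
        simpa using this
    _ = 3 * r * I.weight O := by
        rw [weight, ← Finset.mul_sum]; ring

/-- The strict bound `B` replaces the weight of `O` so that the logarithms and divisions make sense
when that weight is zero. -/
theorem jointSet_spec {r : ℕ} (hr : I.IsSparse r) (hr2 : 2 ≤ r) {O : Finset (Fin n)}
    (hO : I.Feasible O) {B : ℝ} (hB : I.weight O < B) :
    I.weight (jointSet I.f I.w) ≤ 6 * B * Real.log r ∧
      deficit I.f (singleCost I.f I.w) (jointSet I.f I.w) ≤ B := by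
  have hW : 0 ≤ I.weight O := Finset.sum_nonneg fun i _ => I.w_nonneg i
  have hB0 : 0 < B := hW.trans_lt hB
  have hr' : (2 : ℝ) ≤ r := by exact_mod_cast hr2
  have hD : IsDeficit (deficit I.f (singleCost I.f I.w)) I.w O := by
    refine I.isDeficit I.singleCost_nonneg fun j hj _ => ?_
    simpa [oracleAnswer, hj] using hO ⟨j, hj⟩
  set D := deficit I.f (singleCost I.f I.w)
  have hQ : ∀ S, D S ≤ 3 * r * B := fun S => by
    refine le_trans ?_ ((I.sum_singleCost_le hr hO).trans
      (mul_le_mul_of_nonneg_left hB.le (by positivity)))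
    refine Finset.sum_le_sum fun j hj => mul_le_of_le_one_right (I.singleCost_nonneg j) ?_
    have : 0 ≤ min 1 (oracleAnswer I.f j S) := by
      refine le_min zero_le_one ?_
      simp only [oracleAnswer, Finset.mem_range.1 hj, dif_pos]
      exact I.f_nonneg _ _
    linarith
  obtain ⟨s1, s2⟩ := hD.greedySet_spec (d := 0) (l := 1) zero_le_one
    -- Both greedy inequalities are used: adding `w x * D S ≤ B * Δ` and `B * w x ≤ B * Δ`, where
    -- `Δ` is the decrease, gives `w x ≤ 2 * B * Δ / (B + D S)`. This is at most `2 * B` times the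
    -- drop of `log (B + D)`.
    (fun S => ∑ i ∈ S, I.w i ≤ 2 * B * (Real.log (B + 3 * r * B) - Real.log (B + D S)))
    (by
      rw [I.sum_nullSet]
      have h0 := hD.nonneg (nullSet I.w)
      have := Real.log_le_log (show 0 < B + D (nullSet I.w) by linarith)
        (show B + D (nullSet I.w) ≤ B + 3 * r * B by linarith [hQ (nullSet I.w)])
      exact mul_nonneg (by positivity) (by linarith))
    (fun S x hx hP hd hs hl => by
      rw [Finset.sum_insert hx]
      have h0 := hD.nonneg (insert x S)
      have p1 : 0 < B + D S := by linarith
      have p2 : 0 < B + D (insert x S) := by linarith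
      have hdd : 0 ≤ D S - D (insert x S) := by linarith [hD.anti (Finset.subset_insert x S)]
      have h1 : I.w x * D S ≤ B * (D S - D (insert x S)) :=
        hs.trans (mul_le_mul_of_nonneg_right hB.le hdd)
      have h2 := Real.one_sub_inv_le_log_of_pos (div_pos p1 p2)
      rw [Real.log_div p1.ne' p2.ne', inv_div, one_sub_div p1.ne'] at h2
      have h3 : I.w x ≤ 2 * B * ((B + D S - (B + D (insert x S))) / (B + D S)) := by
        rw [← mul_div_assoc, le_div_iff₀ p1]
        nlinarith
      have h4 := mul_le_mul_of_nonneg_left h2 (show 0 ≤ 2 * B by positivity)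
      linarith)
  change D (jointSet I.f I.w) ≤ 0 ∨ D (jointSet I.f I.w) ≤ 1 * I.weight O at s2
  change I.weight (jointSet I.f I.w) ≤
    2 * B * (Real.log (B + 3 * r * B) - Real.log (B + D (jointSet I.f I.w))) at s1
  constructor
  · refine s1.trans ?_
    have h0 := hD.nonneg (jointSet I.f I.w)
    have h1 := Real.log_le_log hB0 (show B ≤ B + D (jointSet I.f I.w) by linarith)
    have h2 : Real.log (B + 3 * r * B) ≤ Real.log (r ^ 3 * B) := by
      refine Real.log_le_log (by positivity) ?_
      -- This is where `r ≥ 2` enters; it turns the logarithm of `1 + 3 * r` into `3 * log r`.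
      have : (1 : ℝ) + 3 * r ≤ r ^ 3 := by nlinarith [mul_nonneg (sub_nonneg.2 hr') (sub_nonneg.2 hr')]
      nlinarith
    rw [Real.log_mul (by positivity) hB0.ne', Real.log_pow] at h2
    push_cast at h2
    have : Real.log (B + 3 * r * B) - Real.log (B + D (jointSet I.f I.w)) ≤ 3 * Real.log r := by
      linarith
    nlinarith
  · rcases s2 with s2 | s2 <;> linarith

theorem jointSet_subset_repairSet (i : ℕ) : jointSet I.f I.w ⊆ repairSet I.f I.w i := by
  induction i with
  | zero => exact subset_rfl
  | succ i ih =>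
    rw [repairSet]
    split_ifs
    · exact ih
    · exact ih.trans Finset.subset_union_left

theorem repairSet_covers {O : Finset (Fin n)} (hO : I.Feasible O) {i : ℕ} (hi : i ≤ h) :
    ∀ j < i, 2 / 3 ≤ oracleAnswer I.f j (repairSet I.f I.w i) := by
  induction i with
  | zero => simp
  | succ i ih =>
    intro j hj
    rw [repairSet]
    split_ifs with hc
    · rcases Nat.lt_succ_iff_lt_or_eq.1 hj with hj | rfl
      · exact ih (by omega) j hj
      · exact hc
    · rcases Nat.lt_succ_iff_lt_or_eq.1 hj with hj | rfl
      · exact (ih (by omega) j hj).trans (I.oracleAnswer_mono Finset.subset_union_left)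
      · refine (I.singleSet_spec (A := O) (by omega) ?_).2.trans
          (I.oracleAnswer_mono Finset.subset_union_right)
        have hj' : j < h := by omega
        simpa [oracleAnswer, hj'] using hO ⟨j, hj'⟩

/-- A constraint repaired now was also below `2/3` for the smaller joint set, so at least a third of
its cost is still counted in the joint deficit. -/
theorem weight_repairSet_le {i : ℕ} (hi : i ≤ h) :
    I.weight (repairSet I.f I.w i) ≤ I.weight (jointSet I.f I.w) +
      3 * deficit I.f (singleCost I.f I.w) (jointSet I.f I.w) := by
  have hterm : ∀ j, 0 ≤ singleCost I.f I.w j *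
      (1 - min 1 (oracleAnswer I.f j (jointSet I.f I.w))) := fun j =>
    mul_nonneg (I.singleCost_nonneg j) (sub_nonneg.2 (min_le_left _ _))
  have key : ∀ i, I.weight (repairSet I.f I.w i) ≤ I.weight (jointSet I.f I.w) +
      3 * ∑ j ∈ Finset.range i, singleCost I.f I.w j *
        (1 - min 1 (oracleAnswer I.f j (jointSet I.f I.w))) := by
    intro i
    induction i with
    | zero => simp [repairSet]
    | succ i ih =>
      rw [repairSet, Finset.sum_range_succ]
      split_ifs with hc
      · linarith [hterm i]
      · have h1 : I.weight (repairSet I.f I.w i ∪ singleSet I.f I.w i) ≤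
            I.weight (repairSet I.f I.w i) + singleCost I.f I.w i := by
          have := Finset.sum_union_inter (s₁ := repairSet I.f I.w i) (s₂ := singleSet I.f I.w i)
            (f := I.w)
          have h0 : 0 ≤ ∑ x ∈ repairSet I.f I.w i ∩ singleSet I.f I.w i, I.w x :=
            Finset.sum_nonneg fun i _ => I.w_nonneg i
          simp only [weight, singleCost]
          linarith
        have h2 : min 1 (oracleAnswer I.f i (jointSet I.f I.w)) ≤ 2 / 3 :=
          (min_le_right _ _).trans
            ((I.oracleAnswer_mono (I.jointSet_subset_repairSet i)).trans (not_le.1 hc).le)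
        nlinarith [I.singleCost_nonneg i]
  refine (key i).trans ?_
  unfold deficit
  have := Finset.sum_le_sum_of_subset_of_nonneg (Finset.range_subset_range.2 hi)
    fun j _ _ => hterm j
  linarith

theorem exists_weight_eq_opt (hI : ∃ S, I.Feasible S) : ∃ O, I.Feasible O ∧ I.weight O = I.opt := by
  obtain ⟨S, hS⟩ := hI
  exact Set.Nonempty.csInf_mem (s := I.weight '' {S | I.Feasible S}) ⟨_, S, hS, rfl⟩
    (Set.toFinite _)

theorem weight_repairSet_le_opt (hI : ∃ S, I.Feasible S) {r : ℕ} (hr2 : 2 ≤ r)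
    (hr : I.IsSparse r) : I.weight (repairSet I.f I.w h) ≤ 12 * Real.log r * I.opt := by
  obtain ⟨O, hO, hOo⟩ := I.exists_weight_eq_opt hI
  have hlog : 1 / 2 ≤ Real.log r := by
    have h1 := Real.log_le_log two_pos (show (2 : ℝ) ≤ r by exact_mod_cast hr2)
    linarith [Real.log_two_gt_d9]
  have hpos : 0 < 12 * Real.log r := by linarith
  rw [← div_le_iff₀' hpos]
  -- Let `B` decrease to the optimum. The total `6 * B * log r + 3 * B` is at most `12 * B * log r`,
  -- since `log r ≥ 1 / 2`.
  refine le_of_forall_gt_imp_ge_of_dense fun B hB => ?_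
  rw [← hOo] at hB
  obtain ⟨h1, h2⟩ := I.jointSet_spec hr hr2 hO hB
  have hB0 : 0 ≤ B := (Finset.sum_nonneg fun i _ => I.w_nonneg i).trans hB.le
  rw [div_le_iff₀' hpos]
  have := I.weight_repairSet_le (i := h) le_rfl
  nlinarith

end CoverInstance
-- The algorithm as a verified program
namespace OracleRAM

open Greedy CoverInstance

variable {n h : ℕ} {f : Fin h → Finset (Fin n) → ℝ} {w : Fin n → ℝ}

/-- A temporary write below the frame is harmless if the old value is put back. -/
theorem Same.restoreNat {L L' a i u v : ℕ} {m m' : Memory} (hs : Same L' (m.writeNat a i u) m')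
    (hv : m.nat a i = v) (hL : L ≤ L') : Same L m (m'.writeNat a i v) := by
  intro b hb
  obtain ⟨h1, h2⟩ := hs b (hb.trans_le hL)
  refine ⟨?_, h2⟩
  by_cases hba : b = a
  · subst hba
    simp [Memory.writeNat] at h1 ⊢
    rw [h1, ← hv]
    simp
  · simpa [Memory.writeNat, Function.update_of_ne hba] using h1

theorem Same.restoreReal {L L' a i : ℕ} {x y : ℝ} {m m' : Memory}
    (hs : Same L' (m.writeReal a i x) m') (hy : m.real a i = y) (hL : L ≤ L') :
    Same L m (m'.writeReal a i y) := by
  intro b hb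
  obtain ⟨h1, h2⟩ := hs b (hb.trans_le hL)
  refine ⟨h1, ?_⟩
  by_cases hba : b = a
  · subst hba
    simp [Memory.writeReal] at h2 ⊢
    rw [h2, ← hy]
    simp
  · simpa [Memory.writeReal, Function.update_of_ne hba] using h2

@[simp] theorem Memory.nat_writeReal (m : Memory) (a i : ℕ) (x : ℝ) :
    (m.writeReal a i x).nat = m.nat := rfl

@[simp] theorem Memory.real_writeNat (m : Memory) (a i v : ℕ) :
    (m.writeNat a i v).real = m.real := rfl

theorem Memory.nat_writeNat (m : Memory) (a i v : ℕ) :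
    (m.writeNat a i v).nat = Function.update m.nat a (Function.update (m.nat a) i v) := rfl

theorem Memory.real_writeReal (m : Memory) (a i : ℕ) (x : ℝ) :
    (m.writeReal a i x).real = Function.update m.real a (Function.update (m.real a) i x) := rfl

/-- Flags beyond `n` are ignored, so the sentinel `n` returned by `probe` can be written without a
test. -/
theorem Memory.set_writeNat (m : Memory) (b i : ℕ) :
    (m.writeNat b i 1).set n b = insertNat i (m.set n b) := by
  ext x
  unfold insertNat
  split_ifs with hi
  · by_cases hx : (x : ℕ) = i
    · have : x = ⟨i, hi⟩ := Fin.ext hx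
      simp [Memory.mem_set, Memory.nat_writeNat, this]
    · have : x ≠ ⟨i, hi⟩ := fun h => hx (congrArg Fin.val h)
      simp [Memory.mem_set, Memory.nat_writeNat, this, hx]
  · have hx : (x : ℕ) ≠ i := by omega
    simp [Memory.mem_set, Memory.nat_writeNat, hx]

theorem WP.skip {Q : Memory → Prop} {m : Memory} (hq : Q (m.writeReal 20 0 0)) :
    WP f .skip 1 Q m := WP.setReal (by simpa [NatExp.eval, RealExp.eval] using hq)

/-- The memory holds the instance size and the weights. -/
structure Ready (n h : ℕ) (w : Fin n → ℝ) (m : Memory) : Prop where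
  nat_n : m.nat 0 0 = n
  nat_h : m.nat 0 1 = h
  real_w : ∀ i : Fin n, m.real 1 i = w i

theorem Ready.of_same {L : ℕ} {m m' : Memory} (hR : Ready n h w m) (hs : Same L m m')
    (hL : 2 ≤ L) : Ready n h w m' where
  nat_n := by rw [(hs 0 (by omega)).1, hR.nat_n]
  nat_h := by rw [(hs 0 (by omega)).1, hR.nat_h]
  real_w i := by rw [(hs 1 (by omega)).2, hR.real_w]

/-- The size of the ground set. -/
abbrev sizeExp : NatExp := .get 0 (.const 0)

/-- The number of constraints. -/
abbrev constraintsExp : NatExp := .get 0 (.const 1)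

/-- Compute the deficit of the set in array 6, with the coefficients in array `a`. -/
def deficitProg (a : ℕ) : Prog :=
  .seq (.setReal 12 (.const 0) (.const 0))
    (.forLoop 12 constraintsExp
      (.seq (.query 13 (.const 0) (natVar 12) 6)
        (.ite (.realLe (realVar 13) (.const 1))
          (.setReal 12 (.const 0)
            (.add (realVar 12) (.mul (.get a (natVar 12)) (.sub (.const 1) (realVar 13)))))
          .skip)))

theorem deficitProg_spec {a : ℕ} {m : Memory} (ha : a < 12) (hR : Ready n h w m) :
    WP f (deficitProg a) (h * 7 + 5)
      (fun m' => Same 12 m m' ∧ m'.real 12 0 = deficit f (m.real a) (m.set n 6)) m := by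
  unfold deficitProg
  refine (WP.seq (B₁ := 1) (B₂ := h * (4 + 3) + 3) (WP.setReal ?_)).mono (by omega) fun _ => id
  refine WP.forLoop (fun i m' => Same 12 m m' ∧ m'.real 12 0 =
    ∑ j ∈ Finset.range i, m.real a j * (1 - min 1 (oracleAnswer f j (m.set n 6)))) ?_ ?_ ?_
  · refine ⟨((Same.refl 12 m).writeReal le_rfl).writeNat le_rfl, ?_⟩
    simp [NatExp.eval, RealExp.eval, Memory.real_writeReal]
  · rintro i m' ⟨hs, -⟩
    exact (hR.of_same hs (by omega)).nat_h
  · rintro i m' hi hmi ⟨hs, hv⟩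
    refine WP.seq (B₁ := 1) (B₂ := 2) (WP.query ?_)
    simp only [NatExp.eval, hmi, hs.set (show 6 < 12 by omega)]
    refine WP.ite (B := 1) (fun ht => WP.setReal ?_) (fun ht => WP.skip ?_)
    · simp only [Test.Holds, NatExp.eval, RealExp.eval, Memory.real_writeReal,
        Function.update_self] at ht
      push_cast at ht
      refine ⟨by simpa using hmi, ((((hs.writeReal (by omega)).writeReal (by omega)).writeNat
        (by omega))), ?_⟩
      simp [NatExp.eval, RealExp.eval, Memory.real_writeReal, Finset.sum_range_succ, hv, hmi,
        Function.update_of_ne (show a ≠ 13 by omega), min_eq_right ht, (hs a ha).2]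
    -- A value above 1 contributes no deficit, so skipping it implements the cap.
    · simp only [Test.Holds, NatExp.eval, RealExp.eval, Memory.real_writeReal,
        Function.update_self, not_le] at ht
      push_cast at ht
      refine ⟨by simpa using hmi, ((((hs.writeReal (by omega)).writeReal (by omega)).writeNat
        (by omega))), ?_⟩
      simp [Memory.real_writeReal, Finset.sum_range_succ, hv, min_eq_left ht.le]

/-- Find an element with the largest ratio above `l`. The deficit of the set in array 6 is expected
in the real array 8. -/
def probeProg (a : ℕ) (l : ℚ) : Prog :=
  .seq (.setReal 10 (.const 0) (.const l)) (.seq (.setNat 10 (.const 0) sizeExp)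
    (.forLoop 9 sizeExp
      (.ite (.natLe (.get 6 (natVar 9)) (.const 0))
        (.seq (.setNat 6 (natVar 9) (.const 1))
          (.seq (deficitProg a)
            (.seq (.setNat 6 (natVar 9) (.const 0))
              (.seq (.setReal 11 (.const 0)
                  (.div (.sub (realVar 8) (realVar 12)) (.get 1 (natVar 9))))
                (.ite (.realLe (realVar 11) (realVar 10)) .skip
                  (.seq (.setReal 10 (.const 0) (realVar 11))
                    (.setNat 10 (.const 0) (natVar 9))))))))
        .skip)))

theorem probeProg_spec {a : ℕ} {l : ℚ} {m : Memory} (ha : a < 6) (hR : Ready n h w m)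
    (h8 : m.real 8 0 = deficit f (m.real a) (m.set n 6)) :
    WP f (probeProg a l) (n * (h * 7 + 20) + 7)
      (fun m' => Same 9 m m' ∧
        m'.nat 10 0 = (probe (deficit f (m.real a)) w l (m.set n 6) n).2) m := by
  unfold probeProg
  set D := deficit f (m.real a) with hD
  set S := m.set n 6 with hS
  refine (WP.seq (B₁ := 1) (B₂ := 1 + (n * ((h * 7 + 17) + 3) + 3) + 1) (WP.setReal
    (WP.seq (B₁ := 1) (WP.setNat ?_)))).mono (by ring_nf; omega) fun _ => id
  refine (WP.forLoop (N := n) (fun i m' => Same 9 m m' ∧ m'.real 10 0 = (probe D w l S i).1 ∧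
    m'.nat 10 0 = (probe D w l S i).2) ?_ ?_ ?_).mono le_rfl fun m' hm' => ⟨hm'.1, hm'.2.2⟩
  · refine ⟨(((Same.refl 9 m).writeReal (by omega)).writeNat (by omega)).writeNat (by omega), ?_, ?_⟩
    · simp [NatExp.eval, RealExp.eval, Memory.real_writeReal, probe]
    · simp [NatExp.eval, Memory.nat_writeNat, probe, hR.nat_n]
  · rintro i m' ⟨hs, -⟩
    exact (hR.of_same hs (by omega)).nat_n
  · rintro i m' hi hmi ⟨hs, hv1, hv2⟩
    have hmem : (⟨i, hi⟩ : Fin n) ∉ S ↔ m'.nat 6 i = 0 := by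
      rw [hS, Memory.mem_set, ← (hs 6 (by omega)).1, not_not]
    refine (WP.ite (B := h * 7 + 16) (fun ht => ?_) (fun ht => ?_)).mono (by omega) fun _ => id
    · have h0 : m'.nat 6 i = 0 := by simpa [Test.Holds, NatExp.eval, hmi] using ht
      have hn := hmem.2 h0
      refine (WP.seq (B₁ := 1) (B₂ := (h * 7 + 5) + (1 + (1 + 4 + 1) + 1) + 1)
        (WP.setNat (WP.seq ?_))).mono (by omega) fun _ => id
      simp only [NatExp.eval, hmi]
      have hR' : Ready n h w (m'.writeNat 6 i 1) :=
        (hR.of_same hs (by omega)).of_same ((Same.refl 6 m').writeNat le_rfl) (by omega)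
      refine (deficitProg_spec (f := f) (show a < 12 by omega) hR').mono le_rfl ?_
      rintro m₂ ⟨hs₂, hv₂⟩
      have hset : (m'.writeNat 6 i 1).set n 6 = insert ⟨i, hi⟩ S := by
        rw [Memory.set_writeNat, hs.set (by omega)]
        simp [insertNat, hi, hS]
      rw [hset, Memory.real_writeNat, (hs a (by omega)).2, ← hD] at hv₂
      have hm₂i : m₂.nat 9 0 = i := by
        rw [(hs₂ 9 (by omega)).1]; simpa [Memory.nat_writeNat] using hmi
      refine WP.seq (B₁ := 1) (B₂ := 1 + 4 + 1) (WP.setNat (WP.seq (B₁ := 1) (B₂ := 4) (WP.setReal ?_)))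
      simp only [NatExp.eval, hm₂i]
      -- The trial insertion of element `i` is undone, since its flag was 0 before.
      have hs₃ : Same 12 m' (m₂.writeNat 6 i 0) := hs₂.restoreNat h0 le_rfl
      have hs₃' : Same 9 m (m₂.writeNat 6 i 0) := hs.trans (hs₃.mono (by omega))
      set m₃ := m₂.writeNat 6 i 0
      have hm₃i : m₃.nat 9 0 = i := by rw [(hs₃ 9 (by omega)).1, hmi]
      have hval : RealExp.eval m₃ (.div (.sub (realVar 8) (realVar 12)) (.get 1 (natVar 9))) =
          ratio D w S ⟨i, hi⟩ := by
        simp only [RealExp.eval, NatExp.eval, hm₃i]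
        rw [(hs₃' 8 (by omega)).2, h8, (hs₃' 1 (by omega)).2, show m₃.real 12 0 = _ from hv₂,
          hR.real_w ⟨i, hi⟩]
        rfl
      rw [hval]
      have e1 : m₃.real 10 0 = (probe D w l S i).1 := by rw [(hs₃ 10 (by omega)).2, hv1]
      have e2 : m₃.nat 10 0 = (probe D w l S i).2 := by rw [(hs₃ 10 (by omega)).1, hv2]
      refine WP.ite (B := 3) (fun ht => ?_) (fun ht => ?_)
      · refine (WP.skip ?_).mono (by omega) fun _ => id
        have hle : ¬ (probe D w l S i).1 < ratio D w S ⟨i, hi⟩ := by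
          simpa [Test.Holds, RealExp.eval, NatExp.eval, Memory.real_writeReal, e1] using ht
        refine ⟨by simpa using hm₃i, ((hs₃'.writeReal (by omega)).writeReal (by omega)).writeNat
          (by omega), ?_, ?_⟩
        · simp [Memory.real_writeReal, probe, hi, hle, e1]
        · simp [Memory.nat_writeNat, probe, hi, hle, e2]
      · have hlt : (probe D w l S i).1 < ratio D w S ⟨i, hi⟩ := by
          simpa [Test.Holds, RealExp.eval, NatExp.eval, Memory.real_writeReal, e1] using ht
        refine WP.seq (B₁ := 1) (B₂ := 1) (WP.setReal (WP.setNat ?_))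
        refine ⟨by simpa [Memory.nat_writeNat] using hm₃i,
          (((hs₃'.writeReal (by omega)).writeReal (by omega)).writeNat
          (by omega)).writeNat (by omega), ?_, ?_⟩
        · simp [Memory.real_writeReal, RealExp.eval, NatExp.eval, probe, hi, hlt, hn]
        · simp [Memory.nat_writeNat, NatExp.eval, probe, hi, hlt, hn, hm₃i]
    · have h0 : m'.nat 6 i ≠ 0 := by simpa [Test.Holds, NatExp.eval, hmi] using ht
      have hn : ¬ (⟨i, hi⟩ : Fin n) ∉ S := fun hx => h0 (hmem.1 hx)
      refine (WP.skip ?_).mono (by omega) fun _ => id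
      refine ⟨by simpa using hmi, (hs.writeReal (by omega)).writeNat (by omega), ?_, ?_⟩
      · simp [Memory.real_writeReal, probe, hi, hn, hv1]
      · simp [Memory.nat_writeNat, probe, hi, hn, hv2]

/-- Store the set of elements without weight in array 6. -/
def nullProg : Prog :=
  .forLoop 7 sizeExp
    (.ite (.realLe (.get 1 (natVar 7)) (.const 0))
      (.setNat 6 (natVar 7) (.const 1)) (.setNat 6 (natVar 7) (.const 0)))

theorem nullProg_spec {m : Memory} (hR : Ready n h w m) :
    WP f nullProg (n * 5 + 3) (fun m' => Same 6 m m' ∧ m'.set n 6 = nullSet w) m := by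
  refine (WP.forLoop (N := n) (B := 2) (fun i m' => Same 6 m m' ∧
    ∀ k : Fin n, (k : ℕ) < i → (m'.nat 6 k ≠ 0 ↔ w k ≤ 0)) ?_ ?_ ?_).mono (by omega) ?_
  · exact ⟨(Same.refl 6 m).writeNat (by omega), by simp⟩
  · rintro i m' ⟨hs, -⟩
    exact (hR.of_same hs (by omega)).nat_n
  · rintro i m' hi hmi ⟨hs, hv⟩
    have key : ∀ v, (v ≠ 0 ↔ w ⟨i, hi⟩ ≤ 0) → ((m'.writeNat 6 i v).nat 7 0 = i ∧
        Same 6 m ((m'.writeNat 6 i v).writeNat 7 0 (i + 1)) ∧ ∀ k : Fin n, (k : ℕ) < i + 1 →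
          (((m'.writeNat 6 i v).writeNat 7 0 (i + 1)).nat 6 k ≠ 0 ↔ w k ≤ 0)) := by
      intro v hvw
      refine ⟨by simpa [Memory.nat_writeNat] using hmi,
        (hs.writeNat (by omega)).writeNat (by omega), fun k hk => ?_⟩
      rcases Nat.lt_succ_iff_lt_or_eq.1 hk with hk | hk
      · simpa [Memory.nat_writeNat, hk.ne] using hv k hk
      · have : k = ⟨i, hi⟩ := Fin.ext hk
        subst this
        simpa [Memory.nat_writeNat] using hvw
    have hwi := (hR.of_same hs (by omega)).real_w ⟨i, hi⟩
    simp only at hwi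
    refine WP.ite (B := 1) (fun ht => WP.setNat ?_) (fun ht => WP.setNat ?_)
    · simp only [NatExp.eval, hmi]
      exact key 1 (by simpa [Test.Holds, RealExp.eval, NatExp.eval, hmi, hwi] using ht)
    · simp only [NatExp.eval, hmi]
      exact key 0 (by simpa [Test.Holds, RealExp.eval, NatExp.eval, hmi, hwi] using ht)
  · rintro m' ⟨hs, hv⟩
    refine ⟨hs, ?_⟩
    ext k
    simp [Memory.mem_set, nullSet, hv k k.2]

/-- The greedy algorithm, with the coefficients in array `a`; its result is stored in array 6. -/
def greedyProg (a : ℕ) (d l : ℚ) : Prog :=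
  .seq nullProg
    (.forLoop 7 sizeExp
      (.seq (deficitProg a)
        (.seq (.setReal 8 (.const 0) (realVar 12))
          (.ite (.realLe (realVar 8) (.const d)) .skip
            (.seq (probeProg a l) (.setNat 6 (natVar 10) (.const 1)))))))

/-- A bound for the number of steps of the greedy algorithm. -/
def greedyTime (n h : ℕ) : ℕ := n * 5 + 3 + (n * (h * 7 + n * (h * 7 + 20) + 25) + 3) + 1

theorem greedyProg_spec {a : ℕ} {d l : ℚ} {m : Memory} (ha : a < 6) (hR : Ready n h w m) :
    WP f (greedyProg a d l) (greedyTime n h)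
      (fun m' => Same 6 m m' ∧ m'.set n 6 = greedySet (deficit f (m.real a)) w d l) m := by
  unfold greedyProg greedyTime
  refine WP.seq ((nullProg_spec hR).mono le_rfl ?_)
  rintro m₁ ⟨hs₁, hv₁⟩
  set D := deficit f (m.real a) with hD
  refine (WP.forLoop (N := n) (B := h * 7 + n * (h * 7 + 20) + 22) (fun i m' => Same 6 m m' ∧
    m'.set n 6 = (greedyStep D w d l)^[i] (nullSet w)) ?_ ?_ ?_).mono le_rfl fun _ => id
  · refine ⟨hs₁.writeNat (by omega), ?_⟩
    rw [← hv₁]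
    exact Memory.set_congr (by simp [Memory.nat_writeNat])
  · rintro i m' ⟨hs, -⟩
    exact (hR.of_same hs (by omega)).nat_n
  · rintro i m₂ hi hmi ⟨hs, hv⟩
    have hR₂ := hR.of_same hs (by omega)
    rw [Function.iterate_succ_apply']
    set S := (greedyStep D w d l)^[i] (nullSet w)
    refine (WP.seq (B₂ := 1 + (n * (h * 7 + 20) + 7 + 1 + 1 + 1) + 1)
      ((deficitProg_spec (f := f) (show a < 12 by omega) hR₂).mono le_rfl ?_)).mono
        (by omega) fun _ => id
    rintro m₃ ⟨hs₃, hv₃⟩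
    rw [hv, (hs a ha).2, ← hD] at hv₃
    refine WP.seq (WP.setReal ?_)
    simp only [NatExp.eval, RealExp.eval, hv₃]
    have hs₄ : Same 8 m₂ (m₃.writeReal 8 0 (D S)) := (hs₃.mono (by omega)).writeReal le_rfl
    have h8 : (m₃.writeReal 8 0 (D S)).real 8 0 = D S := by simp [Memory.real_writeReal]
    set m₄ := m₃.writeReal 8 0 (D S)
    have hset₄ : m₄.set n 6 = S := by rw [hs₄.set (by omega), hv]
    have hreal₄ : m₄.real a = m.real a := by rw [(hs₄ a (by omega)).2, (hs a ha).2]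
    have h7 : m₄.nat 7 0 = i := by rw [(hs₄ 7 (by omega)).1, hmi]
    have hs₄' : Same 6 m m₄ := hs.trans (hs₄.mono (by omega))
    refine WP.ite (fun ht => ?_) (fun ht => ?_)
    · have hle : D S ≤ d := by simpa [Test.Holds, RealExp.eval, NatExp.eval, h8] using ht
      refine (WP.skip ?_).mono (by omega) fun _ => id
      refine ⟨by simpa using h7, (hs₄'.writeReal (by omega)).writeNat (by omega), ?_⟩
      rw [greedyStep, if_pos hle, ← hset₄]
      exact Memory.set_congr (by simp [Memory.nat_writeNat])
    · have hle : ¬ D S ≤ d := by simpa [Test.Holds, RealExp.eval, NatExp.eval, h8] using ht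
      refine WP.seq (B₁ := n * (h * 7 + 20) + 7) (B₂ := 1) ((probeProg_spec (f := f) (w := w) ha (hR₂.of_same hs₄ (by omega)) ?_).mono
        le_rfl ?_)
      · rw [h8, hreal₄, hset₄]
      rintro m₅ ⟨hs₅, hv₅⟩
      rw [hreal₄, hset₄, ← hD] at hv₅
      refine WP.setNat ?_
      simp only [NatExp.eval, hv₅]
      refine ⟨?_, ((hs₄'.trans (hs₅.mono (by omega))).writeNat le_rfl).writeNat (by omega), ?_⟩
      · rw [← h7, ← (hs₅ 7 (by omega)).1]
        simp [Memory.nat_writeNat]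
      · rw [greedyStep, if_neg hle, ← hset₄, ← hs₅.set (show 6 < 9 by omega),
          ← Memory.set_writeNat]
        rw [hs₅.set (show 6 < 9 by omega), hset₄]
        exact Memory.set_congr (by simp [Memory.nat_writeNat])

/-- Compute the weight of the set in array 6. -/
def weightProg : Prog :=
  .seq (.setReal 7 (.const 0) (.const 0))
    (.forLoop 7 sizeExp
      (.ite (.natLe (.get 6 (natVar 7)) (.const 0)) .skip
        (.setReal 7 (.const 0) (.add (realVar 7) (.get 1 (natVar 7))))))

theorem weightProg_spec {m : Memory} (hR : Ready n h w m) :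
    WP f weightProg (n * 5 + 5)
      (fun m' => Same 7 m m' ∧ m'.real 7 0 = ∑ i ∈ m.set n 6, w i) m := by
  refine (WP.seq (B₁ := 1) (B₂ := n * (2 + 3) + 3) (WP.setReal ?_)).mono (by omega) fun _ => id
  refine (WP.forLoop (N := n) (fun i m' => Same 7 m m' ∧ m'.real 7 0 =
    ∑ k ∈ Finset.range i, if m.nat 6 k ≠ 0 then m.real 1 k else 0) ?_ ?_ ?_).mono le_rfl ?_
  · refine ⟨((Same.refl 7 m).writeReal le_rfl).writeNat le_rfl, ?_⟩
    simp [NatExp.eval, RealExp.eval, Memory.real_writeReal]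
  · rintro i m' ⟨hs, -⟩
    exact (hR.of_same hs (by omega)).nat_n
  · rintro i m' hi hmi ⟨hs, hv⟩
    refine WP.ite (B := 1) (fun ht => WP.skip ?_) (fun ht => WP.setReal ?_)
    · have h0 : m.nat 6 i = 0 := by
        rw [← (hs 6 (by omega)).1]; simpa [Test.Holds, NatExp.eval, hmi] using ht
      refine ⟨by simpa using hmi, (hs.writeReal (by omega)).writeNat (by omega), ?_⟩
      simp [Memory.real_writeReal, Finset.sum_range_succ, hv, h0]
    · have h0 : m.nat 6 i ≠ 0 := by
        rw [← (hs 6 (by omega)).1]; simpa [Test.Holds, NatExp.eval, hmi] using ht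
      refine ⟨by simpa using hmi, (hs.writeReal (by omega)).writeNat (by omega), ?_⟩
      simp [Memory.real_writeReal, Finset.sum_range_succ, hv, h0, RealExp.eval, NatExp.eval, hmi,
        (hs 1 (by omega)).2]
  · rintro m' ⟨hs, hv⟩
    refine ⟨hs, ?_⟩
    rw [hv, Finset.sum_range, Memory.set, Finset.sum_filter]
    exact Finset.sum_congr rfl fun k _ => by rw [hR.real_w k]

/-- Add the set in array 6 to the set in array 1. -/
def unionProg : Prog :=
  .forLoop 7 sizeExp
    (.ite (.natLe (.get 6 (natVar 7)) (.const 0)) .skip (.setNat 1 (natVar 7) (.const 1)))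

/-- The output array 1 lies below the frame, so the postcondition lists what later code needs
instead of using `Same`. -/
theorem unionProg_spec {m : Memory} (hR : Ready n h w m) :
    WP f unionProg (n * 5 + 3)
      (fun m' => Ready n h w m' ∧ m'.real 2 = m.real 2 ∧ m'.nat 4 = m.nat 4 ∧
        m'.set n 1 = m.set n 1 ∪ m.set n 6) m := by
  refine (WP.forLoop (N := n) (B := 2) (fun i m' => Ready n h w m' ∧ m'.real 2 = m.real 2 ∧
    m'.nat 4 = m.nat 4 ∧ m'.nat 6 = m.nat 6 ∧
    ∀ k : Fin n, m'.nat 1 k ≠ 0 ↔ m.nat 1 k ≠ 0 ∨ ((k : ℕ) < i ∧ m.nat 6 k ≠ 0))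
    ?_ ?_ ?_).mono (by omega) ?_
  · exact ⟨hR.of_same ((Same.refl 6 m).writeNat (by omega)) (by omega), rfl,
      by simp [Memory.nat_writeNat], by simp [Memory.nat_writeNat], by simp [Memory.nat_writeNat]⟩
  · rintro i m' ⟨hR', -⟩
    exact hR'.nat_n
  · rintro i m' hi hmi ⟨hR', h2, h4, h6, hv⟩
    refine WP.ite (B := 1) (fun ht => WP.skip ?_) (fun ht => WP.setNat ?_)
    · have h0 : m.nat 6 i = 0 := by
        rw [← h6]; simpa [Test.Holds, NatExp.eval, hmi] using ht
      refine ⟨by simpa using hmi, hR'.of_same (((Same.refl 6 m').writeReal (by omega)).writeNat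
        (by omega)) (by omega), by simpa [Memory.real_writeReal] using h2,
        by simpa [Memory.nat_writeNat] using h4, by simpa [Memory.nat_writeNat] using h6,
        fun k => ?_⟩
      have hvk := hv k
      by_cases hk : (k : ℕ) = i
      · simpa [Memory.nat_writeNat, hk, h0] using hvk
      · have : (k : ℕ) < i + 1 ↔ (k : ℕ) < i := by omega
        simpa [Memory.nat_writeNat, this] using hvk
    · have h0 : m.nat 6 i ≠ 0 := by
        rw [← h6]; simpa [Test.Holds, NatExp.eval, hmi] using ht
      simp only [NatExp.eval, hmi]
      refine ⟨by simpa [Memory.nat_writeNat] using hmi, ⟨by simpa [Memory.nat_writeNat] using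
        hR'.nat_n, by simpa [Memory.nat_writeNat] using hR'.nat_h, hR'.real_w⟩, h2,
        by simpa [Memory.nat_writeNat] using h4, by simpa [Memory.nat_writeNat] using h6,
        fun k => ?_⟩
      have hvk := hv k
      by_cases hk : (k : ℕ) = i
      · simp [Memory.nat_writeNat, hk, h0]
      · have : (k : ℕ) < i + 1 ↔ (k : ℕ) < i := by omega
        simpa [Memory.nat_writeNat, this, hk] using hvk
  · rintro m' ⟨hR', h2, h4, h6, hv⟩
    refine ⟨hR', h2, h4, ?_⟩
    ext k
    simp [Memory.mem_set, hv k]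

/-- The greedy algorithm for the constraint whose number is in array 4. -/
def singleProg : Prog :=
  .seq (.setReal 2 (natVar 4) (.const 1))
    (.seq (greedyProg 2 (1 / 3) 0) (.setReal 2 (natVar 4) (.const 0)))

/-- Array 2 is all zero outside this routine. One temporary entry 1 makes it `unitCoeff j`, and the
zero is restored afterwards. -/
theorem singleProg_spec {j : ℕ} {m : Memory} (hR : Ready n h w m) (hj : m.nat 4 0 = j)
    (h2 : m.real 2 = fun _ => 0) :
    WP f singleProg (greedyTime n h + 4)
      (fun m' => Same 6 m m' ∧ m'.set n 6 = singleSet f w j) m := by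
  refine (WP.seq (B₁ := 1) (B₂ := greedyTime n h + 1 + 1) (WP.setReal (WP.seq ?_))).mono
    (by omega) fun _ => id
  simp only [NatExp.eval, RealExp.eval, hj, Rat.cast_one]
  refine (greedyProg_spec (f := f) (w := w) (by omega)
    (hR.of_same ((Same.refl 2 m).writeReal le_rfl) le_rfl)).mono le_rfl ?_
  rintro m' ⟨hs, hv⟩
  refine WP.setReal ?_
  have hj' : m'.nat 4 0 = j := by rw [(hs 4 (by omega)).1]; exact hj
  simp only [NatExp.eval, RealExp.eval, hj', Rat.cast_zero]
  refine ⟨hs.restoreReal (by rw [h2]) le_rfl, ?_⟩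
  have h1 : (m.writeReal 2 j 1).real 2 = unitCoeff j := by
    simp [Memory.real_writeReal, h2, unitCoeff]
  rw [h1] at hv
  push_cast at hv
  exact hv

/-- The approximation algorithm. -/
def coverProg : Prog :=
  .ite (.realLe (.const 1) (realVar 0)) .skip
    (.seq
      (.forLoop 4 constraintsExp
        (.seq singleProg (.seq weightProg (.setReal 3 (natVar 4) (realVar 7)))))
      (.seq (greedyProg 3 0 1)
        (.seq unionProg
          (.forLoop 4 constraintsExp
            (.seq (.query 4 (.const 0) (natVar 4) 1)
              (.ite (.realLe (.const (2 / 3)) (realVar 4)) .skip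
                (.seq singleProg unionProg)))))))

/-- A bound for the number of steps of the approximation algorithm. -/
def coverTime (n h : ℕ) : ℕ :=
  (h * (greedyTime n h + n * 5 + 15) + 3) + (greedyTime n h + (n * 5 + 3 +
    (h * (greedyTime n h + n * 5 + 15) + 3) + 1) + 1) + 2

theorem coverProg_spec (I : CoverInstance n h) (ε : ℝ) :
    WP I.f coverProg (coverTime n h)
      (fun m => m.set n 1 = if 1 ≤ ε then ∅ else repairSet I.f I.w h)
      (inputMemory (h := h) I.w ε) := by
  set m₀ := inputMemory (h := h) I.w ε with hm₀
  have hR₀ : Ready n h I.w m₀ := ⟨by simp [hm₀, inputMemory], by simp [hm₀, inputMemory],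
    fun i => by simp [hm₀, inputMemory]⟩
  have hset₀ : m₀.set n 1 = ∅ := by
    ext i; simp [Memory.mem_set, hm₀, inputMemory]
  have hε : m₀.real 0 0 = ε := by simp [hm₀, inputMemory]
  unfold coverProg coverTime
  refine (WP.ite (fun ht => ?_) (fun ht => ?_)).mono le_rfl fun _ => id
  · have h1 : 1 ≤ ε := by simpa [Test.Holds, RealExp.eval, NatExp.eval, hε] using ht
    refine (WP.skip ?_).mono (by omega) fun _ => id
    rw [if_pos h1]
    exact hset₀
  have h1 : ¬ 1 ≤ ε := by simpa [Test.Holds, RealExp.eval, NatExp.eval, hε] using ht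
  rw [if_neg h1]
  refine WP.seq ((WP.forLoop (N := h) (B := greedyTime n h + n * 5 + 12)
    (fun i m => Ready n h I.w m ∧ m.real 2 = (fun _ => 0) ∧ m.set n 1 = ∅ ∧
      ∀ j < i, m.real 3 j = singleCost I.f I.w j) ?_ ?_ ?_).mono le_rfl ?_)
  · exact ⟨hR₀.of_same ((Same.refl 4 m₀).writeNat le_rfl) (by omega),
      by funext i; simp [hm₀, inputMemory], by
        rw [((Same.refl 4 m₀).writeNat le_rfl).set (by omega), hset₀], by simp⟩
  · exact fun i m hm => hm.1.nat_h
  · rintro i m hi hmi ⟨hR, h2, h3, h4⟩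
    refine (WP.seq (B₂ := n * 5 + 5 + 1 + 1) ((singleProg_spec hR hmi h2).mono le_rfl ?_)).mono
      (by omega) fun _ => id
    rintro m₁ ⟨hs₁, hv₁⟩
    refine WP.seq (B₁ := n * 5 + 5) (B₂ := 1) ((weightProg_spec (hR.of_same hs₁ (by omega))).mono le_rfl ?_)
    rintro m₂ ⟨hs₂, hv₂⟩
    have hs := hs₁.trans (hs₂.mono (show 6 ≤ 7 by omega))
    have hmi₂ : m₂.nat 4 0 = i := by rw [(hs 4 (by omega)).1, hmi]
    refine WP.setReal ?_
    simp only [NatExp.eval, RealExp.eval, hmi₂, hv₂, hv₁]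
    have hs3 : Same 3 m ((m₂.writeReal 3 i (∑ x ∈ singleSet I.f I.w i, I.w x)).writeNat 4 0
      (i + 1)) := ((hs.mono (by omega)).writeReal le_rfl).writeNat (by omega)
    refine ⟨by simpa using hmi₂, hR.of_same hs3 (by omega), by rw [(hs3 2 (by omega)).2, h2],
      by rw [hs3.set (by omega), h3], fun j hj => ?_⟩
    rcases Nat.lt_succ_iff_lt_or_eq.1 hj with hj | rfl
    · have := h4 j hj
      rw [← (hs 3 (by omega)).2] at this
      simpa [Memory.real_writeReal, hj.ne] using this
    · simp [Memory.real_writeReal, singleCost]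
  rintro m₁ ⟨hR₁, h2, h3, h4⟩
  refine WP.seq ((greedyProg_spec (f := I.f) (show 3 < 6 by omega) hR₁).mono le_rfl ?_)
  rintro m₂ ⟨hs₂, hv₂⟩
  rw [deficit_congr h4] at hv₂
  refine WP.seq ((unionProg_spec (hR₁.of_same hs₂ (by omega))).mono le_rfl ?_)
  rintro m₃ ⟨hR₃, h2₃, -, hv₃⟩
  rw [hs₂.set (by omega), h3, hv₂, Finset.empty_union] at hv₃
  rw [(hs₂ 2 (by omega)).2, h2] at h2₃
  refine (WP.forLoop (N := h) (B := greedyTime n h + n * 5 + 12)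
    (fun i m => Ready n h I.w m ∧ m.real 2 = (fun _ => 0) ∧ m.set n 1 = repairSet I.f I.w i)
    ?_ ?_ ?_).mono le_rfl fun m hm => hm.2.2
  · have hs := (Same.refl 4 m₃).writeNat (a := 4) (i := 0) (v := 0) le_rfl
    refine ⟨hR₃.of_same hs (by omega), h2₃, ?_⟩
    rw [hs.set (by omega), hv₃, repairSet, jointSet]
    push_cast
    rfl
  · exact fun i m hm => hm.1.nat_h
  · rintro i m hi hmi ⟨hR, hz, hv⟩
    refine (WP.seq (B₁ := 1) (B₂ := greedyTime n h + 4 + (n * 5 + 3) + 1 + 1)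
      (WP.query ?_)).mono (by omega) fun _ => id
    simp only [NatExp.eval, hmi, hv]
    set x := oracleAnswer I.f i (repairSet I.f I.w i) with hx
    have hs₄ : Same 4 m (m.writeReal 4 0 x) := (Same.refl 4 m).writeReal le_rfl
    have h40 : (m.writeReal 4 0 x).real 4 0 = x := by simp [Memory.real_writeReal]
    have hmi₄ : (m.writeReal 4 0 x).nat 4 0 = i := hmi
    set m₄ := m.writeReal 4 0 x
    have hR₄ := hR.of_same hs₄ (by omega)
    have hz₄ : m₄.real 2 = fun _ => 0 := by rw [(hs₄ 2 (by omega)).2, hz]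
    refine WP.ite (fun ht => ?_) (fun ht => ?_)
    · have hc : 2 / 3 ≤ x := by
        simp only [Test.Holds, RealExp.eval, NatExp.eval, h40] at ht
        push_cast at ht
        exact ht
      refine (WP.skip ?_).mono (by omega) fun _ => id
      have hs₅ : Same 4 m₄ ((m₄.writeReal 20 0 0).writeNat 4 0 (i + 1)) :=
        ((Same.refl 4 m₄).writeReal (by omega)).writeNat le_rfl
      refine ⟨hmi₄, hR₄.of_same hs₅ (by omega), by rw [(hs₅ 2 (by omega)).2, hz₄], ?_⟩
      rw [hs₅.set (by omega), hs₄.set (by omega), hv, repairSet, if_pos hc]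
    · have hc : ¬ 2 / 3 ≤ x := by
        simp only [Test.Holds, RealExp.eval, NatExp.eval, h40] at ht
        push_cast at ht
        exact ht
      refine WP.seq ((singleProg_spec hR₄ hmi₄ hz₄).mono le_rfl ?_)
      rintro m₅ ⟨hs₅, hv₅⟩
      refine (unionProg_spec (hR₄.of_same hs₅ (by omega))).mono le_rfl ?_
      rintro m₆ ⟨hR₆, h2₆, h4₆, hv₆⟩
      have hs₆ := (Same.refl 4 m₆).writeNat (a := 4) (i := 0) (v := i + 1) le_rfl
      refine ⟨by rw [h4₆, (hs₅ 4 (by omega)).1, hmi₄], hR₆.of_same hs₆ (by omega), ?_, ?_⟩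
      · rw [(hs₆ 2 (by omega)).2, h2₆, (hs₅ 2 (by omega)).2, hz₄]
      · rw [hs₆.set (by omega), hv₆, hs₅.set (by omega), hs₄.set (by omega), hv, hv₅, repairSet,
          if_neg hc]

/-! ### Polynomial running time and the main theorem -/

theorem greedyTime_le {N : ℕ} (hn : n ≤ N) (hh : h ≤ N) (hN : 1 ≤ N) :
    greedyTime n h ≤ 80 * N ^ 3 := by
  have h1 : n * h ≤ N * N := Nat.mul_le_mul hn hh
  have h2 : n * n ≤ N * N := Nat.mul_le_mul hn hn
  have h3 : n * n * h ≤ N * N * N := Nat.mul_le_mul h2 hh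
  have h4 : N ≤ N * N := Nat.le_mul_of_pos_left N hN
  have h5 : N * N ≤ N * N * N := Nat.le_mul_of_pos_right _ hN
  have : greedyTime n h = 7 * (n * n * h) + 20 * (n * n) + 7 * (n * h) + 30 * n + 7 := by
    unfold greedyTime; ring
  rw [this, show N ^ 3 = N * N * N by ring]
  omega

theorem coverTime_le {N : ℕ} (hn : n ≤ N) (hh : h ≤ N) (hN : 1 ≤ N) :
    coverTime n h ≤ 400 * N ^ 4 := by
  have h0 := greedyTime_le hn hh hN
  have h1 : greedyTime n h + n * 5 + 15 ≤ 100 * N ^ 3 := by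
    have : N ≤ N ^ 3 := Nat.le_self_pow (by norm_num) N
    omega
  have h2 : h * (greedyTime n h + n * 5 + 15) ≤ N * (100 * N ^ 3) := Nat.mul_le_mul hh h1
  have h3 : N * (100 * N ^ 3) = 100 * N ^ 4 := by ring
  have h4 : N ^ 3 ≤ N ^ 4 := Nat.pow_le_pow_right hN (by norm_num)
  have h5 : N ≤ N ^ 3 := Nat.le_self_pow (by norm_num) N
  unfold coverTime
  omega

theorem WP.execute {P : Prog} {B : ℕ} {Q : Memory → Prop} {I : CoverInstance n h} {ε : ℝ}
    (hw : WP I.f P B Q (inputMemory (h := h) I.w ε)) :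
    ∃ T ≤ B, ∃ m, execute P I ε T = PMF.pure ⟨[], m⟩ ∧ Q m := by
  obtain ⟨m, t, ht, hr, hq⟩ := hw
  exact ⟨t, ht, m, by simpa [run, OracleRAM.execute] using hr [] 0, hq⟩

end OracleRAM

theorem CoverInstance.expectedWeight_pure {n h : ℕ} (I : CoverInstance n h) (S : Finset (Fin n)) :
    I.expectedWeight (PMF.pure S) = I.weight S := by
  unfold expectedWeight
  rw [Finset.sum_eq_single_of_mem S (Finset.mem_univ S)]
  · simp
  · intro T _ hT
    simp [PMF.pure_apply, hT]

theorem mainTheorem2 :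
    ∃ (P : OracleRAM.Prog) (C : ℝ) (K d : ℕ),
      ∀ (n h : ℕ) (I : CoverInstance n h) (ε : ℝ), 0 < ε →
        ∃ T : ℕ, (T : ℝ) ≤ K * (n + h + 1 / ε + 1) ^ d ∧
          OracleRAM.HaltsWithin P I ε T ∧
          ((∃ S, I.Feasible S) →
            (∀ S ∈ (OracleRAM.output P I ε T).support,
              ∀ j, 1 - 1 / Real.exp 1 - ε ≤ I.f j S) ∧
            ∀ r : ℕ, 2 ≤ r → I.IsSparse r →
              I.expectedWeight (OracleRAM.output P I ε T) ≤
                C * (1 / ε * Real.log r) * I.opt) := by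
  refine ⟨OracleRAM.coverProg, 12, 400, 4, fun n h I ε hε => ?_⟩
  obtain ⟨T, hT, m, hm, hS⟩ := (OracleRAM.coverProg_spec I ε).execute
  have hout : OracleRAM.output OracleRAM.coverProg I ε T = PMF.pure (m.set n 1) := by
    simp [OracleRAM.output, hm, PMF.pure_map]
  refine ⟨T, ?_, ?_, fun hI => ⟨?_, fun r hr2 hr => ?_⟩⟩
  · have h1 : (T : ℝ) ≤ 400 * ((n + h + 1 : ℕ) : ℝ) ^ 4 := by
      exact_mod_cast hT.trans (OracleRAM.coverTime_le (N := n + h + 1) (by omega) (by omega)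
        (by omega))
    refine h1.trans ?_
    push_cast
    have : 0 < 1 / ε := by positivity
    gcongr ?_ * ?_ ^ 4
    linarith
  · simp [OracleRAM.HaltsWithin, hm]
  · intro S hSs j
    rw [hout, PMF.support_pure, Set.mem_singleton_iff, hS] at hSs
    -- Since `e < 3`, level `2/3` already exceeds `1 - 1/e`, without any help from `ε`.
    have he : 1 / 3 ≤ 1 / Real.exp 1 :=
      one_div_le_one_div_of_le (Real.exp_pos 1) (by linarith [Real.exp_one_lt_d9])
    split_ifs at hSs with h1
    · linarith [I.f_nonneg j S]
    · obtain ⟨O, hO⟩ := hI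
      have := I.repairSet_covers hO le_rfl j j.2
      simp only [OracleRAM.oracleAnswer, j.2, dif_pos, ← hSs] at this
      linarith
  · rw [hout, I.expectedWeight_pure, hS]
    obtain ⟨O, hO, hOo⟩ := I.exists_weight_eq_opt hI
    have hopt : 0 ≤ I.opt := hOo ▸ Finset.sum_nonneg fun i _ => I.w_nonneg i
    have hlog : 0 ≤ Real.log r := Real.log_natCast_nonneg r
    split_ifs with h1
    -- For large `ε` the factor `1 / ε` may be tiny, so only an output of weight zero is safe here.
    · rw [show I.weight ∅ = 0 by simp [CoverInstance.weight]]
      positivity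
    · refine (I.weight_repairSet_le_opt hI hr2 hr).trans ?_
      have : 1 ≤ 1 / ε := (one_le_div hε).2 (not_le.1 h1).le
      gcongr
      exact le_mul_of_one_le_left hlog this
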